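/- Let $(X,d)$ be a compact metric space, let $f:X\to X$ be continuous (for instance a homeomorphism), and let $\pi_0$ be an $f$-invariant and ergodic Borel probability measure on $X$. Let $p>0$; all logarithms are to base $2$. For a finite Borel partition $\mathcal P$ of $X$ put $\mathcal P^n=\bigvee_{i=0}^{n-1}f^{-i}\mathcal P$, $H_{\pi_0}(\mathcal P^n)=-\sum_{P\in\mathcal P^n}\pi_0(P)\log\pi_0(P)$ and $h_{\pi_0}(f;\mathcal P)=\lim_{n\to\infty}\frac1nH_{\pi_0}(\mathcal P^n)$. The metric entropy is $h_{\pi_0}(f)=\sup_{\mathcal P}h_{\pi_0}(f;\mathcal P)\in[0,\infty]$. A coding and estimation policy over a finite non-empty alphabet $\mathcal M$ (that is, over a noiseless channel of capacity $\log|\mathcal M|$) consists of measurable maps $\delta_t:X^{t+1}\to\mathcal M$ and maps $\gamma_t:\mathcal M^{t+1}\to X$, $t=0,1,2,\dots$. From the initial state $x_0$ it produces the symbols $q_t=\delta_t(x_0,f(x_0),\dots,f^t(x_0))$ and the estimates $\hat x_t(x_0)=\gamma_t(q_0,\dots,q_t)$. For $\varepsilon>0$ the policy achieves (E3) if $$\limsup_{t\to\infty}\int_X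 d\bigl(f^t(x_0),\hat x_t(x_0)\bigr)^p\,\pi_0(\mathrm dx_0)\le\varepsilon .$$ Let $C_\varepsilon$ be the smallest capacity $\log m$, $m\in\{1,2,\dots\}$, such that for every $m'\ge m$ some policy over an alphabet with $m'$ symbols achieves (E3) for this $\varepsilon$ ($C_\varepsilon=\infty$ if there is none). Then the limit $C_0:=\lim_{\varepsilon\downarrow0}C_\varepsilon$ exists in $[0,\infty]$, and $$C_0\le\log\bigl(1+\lfloor 2^{h_{\pi_0}(f)}\rfloor\bigr),$$ where the right-hand side is $\infty$ if $h_{\pi_0}(f)=\infty$. -/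

import Mathlib

open MeasureTheory Filter Topology Set
open scoped ENNReal

namespace ZeroDelayCoding

/-- A finite Borel partition of `X`, listed as `cell 0, …, cell (card - 1)`.  Listing an empty cell
is allowed; it changes no entropy, since `0 * log 0 = 0`. -/
structure FiniteBorelPartition (X : Type*) [MeasurableSpace X] where
  /-- the number of cells -/
  card : ℕ
  /-- the cells -/
  cell : Fin card → Set X
  measurableSet_cell : ∀ i, MeasurableSet (cell i)
  pairwise_disjoint : Pairwise fun i j => Disjoint (cell i) (cell j)
  iUnion_cell : ⋃ i, cell i = Set.univ

variable {X : Type*} [MeasurableSpace X]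

/-- The cell `P_{a 0} ∩ f⁻¹(P_{a 1}) ∩ … ∩ f^{-(n-1)}(P_{a (n-1)})` of the join
`P^n = ⋁_{i < n} f^{-i} P`: the points with itinerary `a` of length `n`. -/
def FiniteBorelPartition.joinCell (P : FiniteBorelPartition X) (f : X → X) {n : ℕ}
    (a : Fin n → Fin P.card) : Set X :=
  ⋂ i : Fin n, f^[i] ⁻¹' P.cell (a i)

/-- The base 2 entropy `H_μ(P^n) = - ∑ μ(Q) log₂ μ(Q)`, over the cells `Q` of `P^n`. -/
noncomputable def joinEntropy (f : X → X) (μ : Measure X) (P : FiniteBorelPartition X) (n : ℕ) :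
    ℝ :=
  -∑ a : Fin n → Fin P.card, μ.real (P.joinCell f a) * Real.logb 2 (μ.real (P.joinCell f a))

/-- `h_μ(f; P) = lim_n H_μ(P^n) / n`.  For an `f`-invariant probability measure the limit exists
by subadditivity, hence it is the upper limit. -/
noncomputable def partitionEntropy (f : X → X) (μ : Measure X) (P : FiniteBorelPartition X) :
    ℝ≥0∞ :=
  limsup (fun n : ℕ => ENNReal.ofReal (joinEntropy f μ P n / n)) atTop

/-- The metric (Kolmogorov–Sinai) entropy `h_μ(f)`, in bits: the supremum of `h_μ(f; P)` over all
finite Borel partitions. -/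
noncomputable def metricEntropy (f : X → X) (μ : Measure X) : ℝ≥0∞ :=
  ⨆ P : FiniteBorelPartition X, partitionEntropy f μ P

/-- A causal (zero-delay) coding and estimation policy over the channel alphabet `M`: measurable
coder maps `δ_t : X^{t+1} → M` and estimator maps `γ_t : M^{t+1} → X`. -/
structure Policy (X M : Type*) [MeasurableSpace X] [MeasurableSpace M] where
  /-- the coder map `δ_t` -/
  coder : (t : ℕ) → (Fin (t + 1) → X) → M
  measurable_coder : ∀ t, Measurable (coder t)
  /-- the estimator map `γ_t` -/
  estimator : (t : ℕ) → (Fin (t + 1) → M) → X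

/-- The symbol `q_t = δ_t(x₀, f x₀, …, f^t x₀)` sent at time `t`. -/
def Policy.symbol {M : Type*} [MeasurableSpace M] (c : Policy X M) (f : X → X) (x₀ : X) (t : ℕ) :
    M :=
  c.coder t fun i => f^[i] x₀

/-- The estimate `x̂_t = γ_t(q_0, …, q_t)` of the state `f^t x₀`. -/
def Policy.estimate {M : Type*} [MeasurableSpace M] (c : Policy X M) (f : X → X) (x₀ : X) (t : ℕ) :
    X :=
  c.estimator t fun i => c.symbol f x₀ i

/-- Asymptotic estimation in `p`-th mean up to `ε`:
`limsup_t ∫ d(f^t x₀, x̂_t(x₀))^p π₀(dx₀) ≤ ε`. -/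
def AchievesInMean {X : Type*} [MeasurableSpace X] [MetricSpace X] {M : Type*} [MeasurableSpace M]
    (c : Policy X M) (f : X → X) (π₀ : Measure X) (p ε : ℝ) : Prop :=
  limsup (fun t : ℕ => ∫⁻ x₀, ENNReal.ofReal (dist (f^[t] x₀) (c.estimate f x₀ t) ^ p) ∂π₀) atTop
    ≤ ENNReal.ofReal ε

/-- Some policy over the noiseless channel with `m` symbols achieves the estimation objective. -/
def Achievable {X : Type*} [MeasurableSpace X] [MetricSpace X]
    (f : X → X) (π₀ : Measure X) (p ε : ℝ) (m : ℕ) : Prop :=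
  ∃ c : Policy X (Fin m), AchievesInMean c f π₀ p ε

/-- `C_ε`: the smallest channel capacity `log₂ m` such that the objective with tolerance `ε` is
achievable over this channel and over every channel of larger capacity (`⊤` if there is none). -/
noncomputable def capacityAt {X : Type*} [MeasurableSpace X] [MetricSpace X]
    (f : X → X) (π₀ : Measure X) (p ε : ℝ) : ℝ≥0∞ :=
  sInf {C | ∃ m : ℕ, 1 ≤ m ∧ (∀ m' : ℕ, m ≤ m' → Achievable f π₀ p ε m') ∧
    C = ENNReal.ofReal (Real.logb 2 m)}

/-- The critical capacity `C₀ = lim_{ε ↓ 0} C_ε`. -/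
noncomputable def criticalCapacity {X : Type*} [MeasurableSpace X] [MetricSpace X]
    (f : X → X) (π₀ : Measure X) (p : ℝ) : ℝ≥0∞ :=
  limUnder (𝓝[>] (0 : ℝ)) fun ε => capacityAt f π₀ p ε

/-- `log₂ (1 + ⌊2 ^ h⌋)` for `h ∈ [0, ∞]`, with value `∞` at `h = ∞`. -/
noncomputable def logOneAddFloorTwoPow (h : ℝ≥0∞) : ℝ≥0∞ :=
  if h = ⊤ then ⊤ else ENNReal.ofReal (Real.logb 2 (1 + ⌊(2 : ℝ) ^ h.toReal⌋₊))

end ZeroDelayCoding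

namespace ZeroDelayCoding

/-! Since 1 + ⌊2^h⌋ > 2^h, it suffices to reach every tolerance over each alphabet of m symbols with
h < log m. Code states by a finite partition into cells of small radius; some N has N-block entropy
H < N log m.

The mean ergodic theorem for the information function of N-blocks, with a pigeonhole over residues
mod N, shows that most orbits have an offset from which n consecutive N-blocks carry total
information at most n(H + δ). By `card_words_le` there are at most 2^(n(H + δ)) such block
sequences, so at most m^L words cover the itineraries of some length L up to small measure
(`exists_itinerary_cover`). Neither Shannon–McMillan–Breiman nor ergodicity of f^N is needed.

As x₀ determines the whole orbit, the coder can send each block's itinerary during the preceding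
block (`exists_block_policy`); by invariance the failure probability is equally small for all
blocks. -/

/-! ### Mean ergodic theorem -/

theorem iterate_compMeasurePreserving_ae_eq {α : Type*} [MeasurableSpace α] {μ : Measure α}
    {f : α → α} (hf : MeasurePreserving f μ μ) (G : Lp ℝ 2 μ) (k : ℕ) :
    ((Lp.compMeasurePreserving f hf)^[k] G : Lp ℝ 2 μ) =ᵐ[μ] fun x => G (f^[k] x) := by
  induction k with
  | zero => simp
  | succ k ih =>
    rw [Function.iterate_succ_apply']
    refine (Lp.coeFn_compMeasurePreserving _ hf).trans ?_
    have := hf.quasiMeasurePreserving.ae_eq_comp ih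
    refine this.trans (Eventually.of_forall fun x => ?_)
    simp

/-- The mean ergodic theorem, with convergence in measure. -/
theorem tendstoInMeasure_birkhoffAverage {α : Type*} [MeasurableSpace α] {μ : Measure α}
    [IsProbabilityMeasure μ] {f : α → α} (hf : Ergodic f μ) {g : α → ℝ} (hg : MemLp g 2 μ) :
    TendstoInMeasure μ (fun n => birkhoffAverage ℝ f g n) atTop fun _ => ∫ x, g x ∂μ := by
  have hmp := hf.toMeasurePreserving
  let U : Lp ℝ 2 μ →L[ℝ] Lp ℝ 2 μ :=
    (Lp.compMeasurePreservingₗᵢ ℝ f hmp).toContinuousLinearMap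
  have hU : ‖U‖ ≤ 1 := LinearIsometry.norm_toContinuousLinearMap_le _
  set G : Lp ℝ 2 μ := hg.toLp g
  have hlim := U.tendsto_birkhoffAverage_orthogonalProjection hU G
  set Q := (U.eqLocus (1 : Lp ℝ 2 μ →L[ℝ] Lp ℝ 2 μ)).orthogonalProjectionOnto G with hQ
  have hfix : U (Q : Lp ℝ 2 μ) = Q := Q.2
  -- The limit is Koopman-invariant, hence constant by ergodicity; comparing integrals below
  -- identifies the constant.
  obtain ⟨c, hc⟩ : ∃ c, (Q : Lp ℝ 2 μ) =ᵐ[μ] Function.const α c := by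
    refine hf.ae_eq_const_of_ae_eq_comp_ae (Lp.aestronglyMeasurable _) ?_
    have := Lp.coeFn_compMeasurePreserving (Q : Lp ℝ 2 μ) hmp
    refine this.symm.trans ?_
    rw [show Lp.compMeasurePreserving f hmp (Q : Lp ℝ 2 μ) = Q from hfix]
  have hA : ∀ n, (birkhoffAverage ℝ U id n G : Lp ℝ 2 μ) =ᵐ[μ] birkhoffAverage ℝ f g n := by
    intro n
    have hk : ∀ k, (U^[k] G : Lp ℝ 2 μ) =ᵐ[μ] fun x => g (f^[k] x) := fun k =>
      (iterate_compMeasurePreserving_ae_eq hmp G k).trans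
        ((hmp.iterate k).quasiMeasurePreserving.ae_eq_comp hg.coeFn_toLp)
    have hs : ∀ n, (birkhoffSum U id n G : Lp ℝ 2 μ) =ᵐ[μ] birkhoffSum f g n := by
      intro n
      induction n with
      | zero => simpa [birkhoffSum_zero'] using Lp.coeFn_zero ℝ 2 μ
      | succ n ih =>
        rw [birkhoffSum_succ]
        filter_upwards [Lp.coeFn_add (birkhoffSum U id n G) (id (U^[n] G)), ih, hk n]
          with x h1 h2 h3
        rw [h1, Pi.add_apply, h2, birkhoffSum_succ, id, h3]
    filter_upwards [Lp.coeFn_smul ((n : ℝ)⁻¹) (birkhoffSum U id n G), hs n] with x h1 h2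
    rw [birkhoffAverage, h1, Pi.smul_apply, h2, birkhoffAverage]
  have hint : Integrable g μ := hg.integrable one_le_two
  have hone : ∀ F : Lp ℝ 2 μ, inner ℝ (indicatorConstLp 2 MeasurableSet.univ
      (measure_ne_top μ _) (1 : ℝ)) F = ∫ x, F x ∂μ := by
    intro F
    rw [L2.inner_indicatorConstLp_one]; simp
  have hcint : c = ∫ x, g x ∂μ := by
    have h1 : Tendsto (fun n => ∫ x, (birkhoffAverage ℝ U id n G : Lp ℝ 2 μ) x ∂μ) atTop
        (𝓝 (∫ x, (Q : Lp ℝ 2 μ) x ∂μ)) := by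
      simp_rw [← hone]
      exact tendsto_const_nhds.inner hlim
    have h2 : ∫ x, (Q : Lp ℝ 2 μ) x ∂μ = c := by
      rw [integral_congr_ae hc]; simp
    rw [h2] at h1
    refine tendsto_nhds_unique h1 (tendsto_const_nhds.congr' ?_)
    filter_upwards [eventually_ge_atTop 1] with n hn
    rw [integral_congr_ae (hA n)]
    have hn0 : (n : ℝ) ≠ 0 := by positivity
    simp only [birkhoffAverage, birkhoffSum, smul_eq_mul]
    rw [integral_const_mul, integral_finsetSum]
    · have : ∀ k ∈ Finset.range n, ∫ x, g (f^[k] x) ∂μ = ∫ x, g x ∂μ := by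
        intro k _
        have hk := hmp.iterate k
        have hgm : AEStronglyMeasurable g (Measure.map f^[k] μ) := by
          rw [hk.map_eq]; exact hg.aestronglyMeasurable
        rw [← integral_map hk.aemeasurable hgm, hk.map_eq]
      rw [Finset.sum_congr rfl this]
      simp [hn0]
    · intro k _
      exact (hmp.iterate k).integrable_comp_of_integrable hint
  have := tendstoInMeasure_of_tendsto_Lp hlim
  refine this.congr hA ?_
  rw [← hcint]; exact hc

/-! ### Counting words -/

/-- At most `2 ^ c` words of length `n` have likelihood at least `2 ^ (-c)`. -/
theorem card_words_le {B : Type*} [Fintype B] (q : B → ℝ) (hq : ∀ b, 0 ≤ q b)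
    (hq1 : ∑ b, q b ≤ 1) (n : ℕ) (c : ℝ) (S : Finset (Fin n → B))
    (hS : ∀ b ∈ S, (∀ k, 0 < q (b k)) ∧ ∑ k, -Real.logb 2 (q (b k)) ≤ c) :
    (S.card : ℝ) ≤ 2 ^ c := by
  have h1 : ∀ b ∈ S, (2 : ℝ) ^ (-c) ≤ ∏ k, q (b k) := by
    intro b hb
    obtain ⟨hpos, hsum⟩ := hS b hb
    have : ∏ k, q (b k) = (2 : ℝ) ^ (∑ k, Real.logb 2 (q (b k))) := by
      rw [Real.rpow_sum_of_pos two_pos]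
      exact Finset.prod_congr rfl fun k _ =>
        (Real.rpow_logb two_pos (by norm_num) (hpos k)).symm
    rw [this]
    refine Real.rpow_le_rpow_of_exponent_le one_le_two ?_
    rw [Finset.sum_neg_distrib] at hsum
    linarith
  -- The product weight is only a counting device: no independence of the letters is claimed.
  have h2 : ∑ b ∈ S, ∏ k, q (b k) ≤ 1 := by
    calc ∑ b ∈ S, ∏ k, q (b k) ≤ ∑ b : Fin n → B, ∏ k, q (b k) :=
          Finset.sum_le_sum_of_subset_of_nonneg (Finset.subset_univ _)
            fun b _ _ => Finset.prod_nonneg fun k _ => hq _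
      _ = (∑ b, q b) ^ n := by
          rw [← Fintype.piFinset_univ, ← Finset.prod_univ_sum]; simp
      _ ≤ 1 := pow_le_one₀ (Finset.sum_nonneg fun b _ => hq b) hq1
  have h3 : (S.card : ℝ) * 2 ^ (-c) ≤ 1 := by
    refine le_trans ?_ h2
    rw [← nsmul_eq_mul]
    exact Finset.card_nsmul_le_sum _ _ _ h1
  rw [Real.rpow_neg two_pos.le] at h3
  have := Real.rpow_pos_of_pos two_pos c
  rwa [← div_eq_mul_inv, div_le_one this] at h3

/-! ### Block coding -/

/-- The itinerary of length `n` of a point, with respect to the coding map `ξ`. -/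
def itinerary {X A : Type*} (f : X → X) (ξ : X → A) (n : ℕ) (x : X) : Fin n → A :=
  fun i => ξ (f^[i] x)

theorem measurable_itinerary {X A : Type*} [MeasurableSpace X] [MeasurableSpace A] {f : X → X}
    (hf : Measurable f) {ξ : X → A} (hξ : Measurable ξ) (n : ℕ) :
    Measurable (itinerary f ξ n) :=
  measurable_pi_lambda _ fun i => hξ.comp (hf.iterate i)

/-- During each block of `L` time units the coder sends the itinerary over the next block. -/
theorem exists_block_policy {X A : Type*} [MetricSpace X] [MeasurableSpace X] [Fintype A]
    [MeasurableSpace A] [DiscreteMeasurableSpace A]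
    {f : X → X} {μ : Measure X} [IsProbabilityMeasure μ] (hf : MeasurePreserving f μ μ) {ξ : X → A}
    (hξ : Measurable ξ) {m L : ℕ} (hm : 0 < m) (hL : 0 < L) (S : Finset (Fin L → A))
    (hS : S.card ≤ m ^ L) (rep : A → X) {r D p : ℝ} (hp : 0 < p)
    (hr : ∀ x, dist x (rep (ξ x)) ≤ r) (hD : ∀ x y : X, dist x y ≤ D) :
    ∃ c : Policy X (Fin m), ∀ t, L ≤ t →
      ∫⁻ x, ENNReal.ofReal (dist (f^[t] x) (c.estimate f x t) ^ p) ∂μ ≤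
        ENNReal.ofReal (r ^ p) + ENNReal.ofReal (D ^ p) * μ {x | itinerary f ξ L x ∉ S} := by
  classical
  obtain ⟨x₀⟩ : Nonempty X := nonempty_of_isProbabilityMeasure μ
  have : Nonempty A := ⟨ξ x₀⟩
  have : Nonempty (Fin m) := ⟨⟨0, hm⟩⟩
  obtain ⟨e, -, he⟩ : ∃ e : (Fin L → A) → (Fin L → Fin m),
      (S : Set (Fin L → A)) ⊆ e ⁻¹' univ ∧ InjOn e S := by
    refine S.finite_toSet.exists_injOn_of_encard_le ?_
    rw [Set.encard_coe_eq_coe_finsetCard, Set.encard_univ, ENat.card_eq_coe_fintype_card]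
    simpa using (by exact_mod_cast hS : (S.card : ℕ∞) ≤ (m : ℕ∞) ^ L)
  set d : (Fin L → Fin m) → (Fin L → A) := Function.invFunOn e S
  have hde : ∀ w ∈ S, d (e w) = w := fun w hw => he.leftInvOn_invFunOn hw
  have hfm := hf.measurable
  let c : Policy X (Fin m) :=
    -- The state at the start of the next block is computed from x₀ alone.
    { coder := fun t y => e (itinerary f ξ L (f^[(t / L + 1) * L] (y 0))) ⟨t % L, Nat.mod_lt _ hL⟩
      measurable_coder := fun t => by
        have h1 : Measurable fun w : Fin L → A => e w ⟨t % L, Nat.mod_lt _ hL⟩ :=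
          measurable_of_finite _
        exact h1.comp ((measurable_itinerary hfm hξ L).comp
          ((hfm.iterate _).comp (measurable_pi_apply _)))
      estimator := fun t q =>
        -- Reads the symbols of the preceding block. For t ≥ L these indices are at most t, so the
        -- reduction mod t + 1 is harmless; earlier values are irrelevant.
        rep (d (fun i => q (Fin.ofNat (t + 1) ((t / L - 1) * L + i))) ⟨t % L, Nat.mod_lt _ hL⟩) }
  refine ⟨c, fun t ht => ?_⟩
  set s := t / L with hs
  have hs1 : 1 ≤ s := (Nat.one_le_div_iff hL).2 ht
  have hts : t = s * L + t % L := by rw [hs, mul_comm]; exact (Nat.div_add_mod t L).symm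
  have hest : ∀ x, itinerary f ξ L (f^[s * L] x) ∈ S →
      c.estimate f x t = rep (ξ (f^[t] x)) := by
    intro x hx
    have hsym : ∀ i : Fin L, c.symbol f x ((s - 1) * L + i) = e (itinerary f ξ L (f^[s * L] x)) i := by
      intro i
      have h1 : ((s - 1) * L + (i : ℕ)) / L = s - 1 := by
        rw [mul_comm, Nat.mul_add_div hL, Nat.div_eq_of_lt i.2, add_zero]
      have h2 : ((s - 1) * L + (i : ℕ)) % L = i := by
        rw [mul_comm, Nat.mul_add_mod, Nat.mod_eq_of_lt i.2]
      simp only [Policy.symbol, c, h1, h2, Nat.sub_add_cancel hs1]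
      simp
    have hval : ∀ i : Fin L, ((Fin.ofNat (t + 1) ((s - 1) * L + i) : Fin (t + 1)) : ℕ)
        = (s - 1) * L + i := by
      intro i
      rw [Fin.val_ofNat]
      refine Nat.mod_eq_of_lt ?_
      have h3 : (s - 1) * L + L = s * L := by
        rw [← Nat.succ_mul, Nat.succ_eq_add_one, Nat.sub_add_cancel hs1]
      have := i.2
      omega
    have : c.estimate f x t
        = rep (d (fun i => c.symbol f x
          ((Fin.ofNat (t + 1) ((s - 1) * L + i) : Fin (t + 1)) : ℕ)) ⟨t % L, Nat.mod_lt _ hL⟩) := rfl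
    rw [this]
    simp only [hval, hsym]
    rw [hde _ hx]
    simp only [itinerary]
    rw [← Function.iterate_add_apply, add_comm, ← hts]
  set B : Set X := {x | itinerary f ξ L x ∉ S} with hB
  have hBm : MeasurableSet B :=
    (measurable_itinerary hfm hξ L) (MeasurableSet.of_discrete (s := {w | w ∉ S}))
  have hpt : ∀ x, ENNReal.ofReal (dist (f^[t] x) (c.estimate f x t) ^ p) ≤
      ENNReal.ofReal (r ^ p) + (f^[s * L] ⁻¹' B).indicator (fun _ => ENNReal.ofReal (D ^ p)) x := by
    intro x
    by_cases hx : itinerary f ξ L (f^[s * L] x) ∈ S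
    · rw [hest x hx]
      refine le_add_right (ENNReal.ofReal_le_ofReal ?_)
      exact Real.rpow_le_rpow dist_nonneg (hr _) hp.le
    · rw [indicator_of_mem (show x ∈ f^[s * L] ⁻¹' B from hx)]
      refine le_add_left (ENNReal.ofReal_le_ofReal ?_)
      exact Real.rpow_le_rpow dist_nonneg (hD _ _) hp.le
  calc ∫⁻ x, ENNReal.ofReal (dist (f^[t] x) (c.estimate f x t) ^ p) ∂μ
      ≤ ∫⁻ x, ENNReal.ofReal (r ^ p) +
          (f^[s * L] ⁻¹' B).indicator (fun _ => ENNReal.ofReal (D ^ p)) x ∂μ :=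
        lintegral_mono hpt
    _ = _ := by
        rw [lintegral_add_left measurable_const, lintegral_const, measure_univ, mul_one,
          lintegral_indicator_const ((hfm.iterate _) hBm),
          (hf.iterate _).measure_preimage hBm.nullMeasurableSet]

/-! ### Fine partitions -/

/-- A coding map into a finite set with cells of radius at most `r`. -/
theorem exists_measurable_fin_dist_le (X : Type*) [MetricSpace X] [CompactSpace X] [Nonempty X]
    [MeasurableSpace X] [BorelSpace X] {r : ℝ} (hr : 0 < r) :
    ∃ (n : ℕ) (ξ : X → Fin n) (rep : Fin n → X), Measurable ξ ∧ ∀ x, dist x (rep (ξ x)) ≤ r := by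
  let e := TopologicalSpace.denseSeq X
  obtain ⟨t, ht⟩ := (isCompact_univ (X := X)).elim_finite_subcover (fun k => Metric.ball (e k) r)
    (fun _ => Metric.isOpen_ball) fun x _ => by
      obtain ⟨k, hk⟩ := (TopologicalSpace.denseRange_denseSeq X).exists_dist_lt x hr
      exact mem_iUnion.2 ⟨k, hk⟩
  set N := t.sup id
  have hlt : ∀ x, SimpleFunc.nearestPtInd e N x < N + 1 := fun x =>
    Nat.lt_succ_of_le (SimpleFunc.nearestPtInd_le e N x)
  refine ⟨N + 1, fun x => ⟨SimpleFunc.nearestPtInd e N x, hlt x⟩, fun i => e i, ?_, fun x => ?_⟩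
  · refine measurable_to_countable' fun i => ?_
    convert (SimpleFunc.nearestPtInd e N).measurableSet_fiber i using 1
    ext x
    simp [Fin.ext_iff]
  · obtain ⟨k, hk, hxk⟩ := mem_iUnion₂.1 (ht (mem_univ x))
    have h := SimpleFunc.edist_nearestPt_le e x (Finset.le_sup (f := id) hk : k ≤ N)
    rw [edist_dist, edist_dist, ENNReal.ofReal_le_ofReal_iff dist_nonneg] at h
    rw [Metric.mem_ball, dist_comm] at hxk
    rw [dist_comm]
    exact h.trans hxk.le

/-- The partition into the fibres of a coding map. -/
def FiniteBorelPartition.ofMap {X : Type*} [MeasurableSpace X] {n : ℕ} (ξ : X → Fin n)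
    (hξ : Measurable ξ) : FiniteBorelPartition X where
  card := n
  cell i := ξ ⁻¹' {i}
  measurableSet_cell i := hξ (measurableSet_singleton i)
  pairwise_disjoint i j hij := by
    refine Disjoint.preimage _ ?_
    simpa using hij
  iUnion_cell := by
    ext x; simp

theorem joinEntropy_ofMap {X : Type*} [MeasurableSpace X] {n : ℕ} (ξ : X → Fin n)
    (hξ : Measurable ξ) (f : X → X) (μ : Measure X) (N : ℕ) :
    joinEntropy f μ (FiniteBorelPartition.ofMap ξ hξ) N =
      -∑ b : Fin N → Fin n, μ.real (itinerary f ξ N ⁻¹' {b}) *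
        Real.logb 2 (μ.real (itinerary f ξ N ⁻¹' {b})) := by
  have h : ∀ b : Fin N → Fin n, (FiniteBorelPartition.ofMap ξ hξ).joinCell f b =
      itinerary f ξ N ⁻¹' {b} := by
    intro b
    ext x
    simp [FiniteBorelPartition.joinCell, FiniteBorelPartition.ofMap, itinerary, funext_iff]
  simp only [← h]
  rfl

/-! ### Covering itineraries by few words -/

theorem sum_range_mul_eq_sum_sum {M : Type*} [AddCommMonoid M] (u : ℕ → M) (n N : ℕ) :
    ∑ i ∈ Finset.range (n * N), u i =
      ∑ j ∈ Finset.range N, ∑ k ∈ Finset.range n, u (j + k * N) := by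
  rw [Finset.sum_comm]
  induction n with
  | zero => simp
  | succ n ih =>
    rw [Nat.succ_mul, Finset.sum_range_add, ih, Finset.sum_range_succ]
    simp only [add_comm]

/-- The word of length `(n + 1) * N` made of the `n` consecutive blocks `b` of length `N`, placed
from position `j` on, and of the letters `r` in the remaining `N` positions. -/
def spliceWord {A : Type*} {n N : ℕ} (hN : 0 < N) (w : Fin N × (Fin N → A) × (Fin n → Fin N → A)) :
    Fin ((n + 1) * N) → A := fun i =>
  if h : (w.1 : ℕ) ≤ i ∧ ((i : ℕ) - w.1) / N < n then
    w.2.2 ⟨((i : ℕ) - w.1) / N, h.2⟩ ⟨((i : ℕ) - w.1) % N, Nat.mod_lt _ hN⟩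
  else w.2.1 ⟨i % N, Nat.mod_lt _ hN⟩

theorem exists_itinerary_eq_spliceWord {X A : Type*} (f : X → X) (ξ : X → A) {n N : ℕ}
    (hN : 0 < N) (x : X) (j : Fin N) : ∃ r : Fin N → A,
      itinerary f ξ ((n + 1) * N) x =
        spliceWord hN (j, r, fun k => itinerary f ξ N (f^[j + k * N] x)) := by
  -- The positions outside the blocks, [0, j) and [j + nN, (n + 1)N), meet each residue mod N
  -- exactly once.
  refine ⟨fun l => if l < j then ξ (f^[l] x) else ξ (f^[l + n * N] x), ?_⟩
  funext ⟨i, hi⟩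
  rw [Nat.succ_mul] at hi
  have hj := j.2
  have hmod : n * N ≤ i → i % N = i - n * N := by
    intro h
    obtain ⟨c, rfl⟩ := Nat.exists_eq_add_of_le h
    rw [mul_comm n N, Nat.mul_add_mod, Nat.mod_eq_of_lt] <;> omega
  have hge : ¬((j : ℕ) ≤ i ∧ (i - j) / N < n) → (j : ℕ) ≤ i → n * N ≤ i - j := by
    intro h hij
    rw [← Nat.le_div_iff_mul_le hN]
    exact not_lt.1 fun h' => h ⟨hij, h'⟩
  simp only [spliceWord, itinerary]
  split_ifs with h h2
  · rw [← Function.iterate_add_apply]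
    congr 2
    have := Nat.mod_add_div (i - j) N
    rw [mul_comm N] at this
    omega
  all_goals
    rw [Fin.lt_def] at h2
    simp only at h2
    congr 2
    by_cases hij : (j : ℕ) ≤ i
    · have h3 := hge h hij
      have h4 := hmod (by omega)
      omega
    · have h4 := Nat.mod_eq_of_lt (show i < N by omega)
      omega

/-- If the entropy of itineraries of length `N` is less than `N * log m`, then for some `L` all
but a small set of points have their itineraries of length `L` in a set of at most `m ^ L` words. -/
theorem exists_itinerary_cover {X A : Type*} [MeasurableSpace X] [Fintype A] [MeasurableSpace A]
    [DiscreteMeasurableSpace A] {f : X → X} {μ : Measure X} [IsProbabilityMeasure μ]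
    (hf : Ergodic f μ) {ξ : X → A} (hξ : Measurable ξ) {m N : ℕ} (hm : 0 < m) (hN : 0 < N)
    (hH : -∑ b : Fin N → A, μ.real (itinerary f ξ N ⁻¹' {b}) *
        Real.logb 2 (μ.real (itinerary f ξ N ⁻¹' {b})) < N * Real.logb 2 m)
    {η : ℝ≥0∞} (hη : 0 < η) :
    ∃ (L : ℕ) (S : Finset (Fin L → A)), 0 < L ∧ S.card ≤ m ^ L ∧
      μ {x | itinerary f ξ L x ∉ S} ≤ η := by
  classical
  set q : (Fin N → A) → ℝ := fun b => μ.real (itinerary f ξ N ⁻¹' {b}) with hq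
  set H := -∑ b, q b * Real.logb 2 (q b) with hHdef
  have hitm := measurable_itinerary hf.measurable hξ N
  have : IsProbabilityMeasure (μ.map (itinerary f ξ N)) :=
    Measure.isProbabilityMeasure_map hitm.aemeasurable
  have hqmap : ∀ b, (μ.map (itinerary f ξ N)).real {b} = q b := fun b => by
    rw [map_measureReal_apply hitm (measurableSet_singleton b)]
  have hq1 : ∑ b, q b ≤ 1 := by
    simp_rw [← hqmap]
    rw [sum_measureReal_singleton]
    exact measureReal_le_one
  set φ : (Fin N → A) → ℝ := fun b => -Real.logb 2 (q b) with hφ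
  set g : X → ℝ := fun x => φ (itinerary f ξ N x) with hg
  have hφm : Measurable φ := measurable_of_finite _
  have hgL : MemLp g 2 μ := by
    refine MemLp.of_bound (hφm.comp hitm).aestronglyMeasurable (∑ b, ‖φ b‖)
      (Eventually.of_forall fun x => ?_)
    exact Finset.single_le_sum (f := fun b => ‖φ b‖) (fun b _ => norm_nonneg _)
      (Finset.mem_univ (itinerary f ξ N x))
  have hgint : ∫ x, g x ∂μ = H := by
    rw [hg, ← integral_map hitm.aemeasurable hφm.aestronglyMeasurable,
      integral_fintype Integrable.of_finite]
    simp_rw [hqmap]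
    simp [hφ, hHdef]
  -- Half the gap: one δ absorbs the ergodic error, the other the factor N * |A|^N for the offset
  -- and boundary letters.
  set δ := (N * Real.logb 2 m - H) / 2 with hδ
  have hδ0 : 0 < δ := by rw [hδ]; linarith
  have herg := tendstoInMeasure_birkhoffAverage hf hgL
  rw [tendstoInMeasure_iff_norm] at herg
  have hsub := (herg δ hδ0).comp (tendsto_id.atTop_mul_const' hN)
  have hev1 := hsub.eventually (Iic_mem_nhds hη)
  have hev2 : ∀ᶠ n : ℕ in atTop,
      (N : ℝ) * (Fintype.card A : ℝ) ^ N ≤ ((2 : ℝ) ^ δ) ^ n :=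
    (tendsto_pow_atTop_atTop_of_one_lt (Real.one_lt_rpow one_lt_two hδ0)).eventually_ge_atTop _
  obtain ⟨n, hn1, hn2, hn0⟩ := (hev1.and (hev2.and (eventually_ge_atTop 1))).exists
  set 𝓑 : Finset (Fin n → Fin N → A) :=
    {b | (∀ k, 0 < q (b k)) ∧ ∑ k, φ (b k) ≤ n * (H + δ)} with h𝓑
  have h𝓑card : (𝓑.card : ℝ) ≤ 2 ^ (n * (H + δ)) :=
    card_words_le q (fun b => measureReal_nonneg) hq1 n _ 𝓑 fun b hb => by
      exact (Finset.mem_filter.1 hb).2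
  refine ⟨(n + 1) * N, (Finset.univ ×ˢ Finset.univ ×ˢ 𝓑).image (spliceWord hN), by positivity,
    ?_, ?_⟩
  · refine Finset.card_image_le.trans ?_
    rw [Finset.card_product, Finset.card_product, Finset.card_univ, Finset.card_univ,
      Fintype.card_fin, Fintype.card_fun, Fintype.card_fin]
    have hm0 : (0 : ℝ) < m := by exact_mod_cast hm
    have hpow : (2 : ℝ) ^ (n * (H + δ)) * ((2 : ℝ) ^ δ) ^ n = (m : ℝ) ^ (n * N) := by
      rw [← Real.rpow_natCast (2 ^ δ), ← Real.rpow_mul two_pos.le, ← Real.rpow_add two_pos,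
        ← Real.rpow_natCast (m : ℝ) (n * N)]
      conv_rhs => rw [← Real.rpow_logb two_pos (by norm_num) hm0]
      rw [← Real.rpow_mul two_pos.le]
      congr 1
      rw [hδ]; push_cast; ring
    have : (N : ℝ) * ((Fintype.card A : ℝ) ^ N * 𝓑.card) ≤ (m : ℝ) ^ ((n + 1) * N) := by
      calc (N : ℝ) * ((Fintype.card A : ℝ) ^ N * 𝓑.card)
          = (N * (Fintype.card A : ℝ) ^ N) * 𝓑.card := by ring
        _ ≤ ((2 : ℝ) ^ δ) ^ n * 2 ^ (n * (H + δ)) := by gcongr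
        _ = (m : ℝ) ^ (n * N) := by rw [mul_comm, hpow]
        _ ≤ (m : ℝ) ^ ((n + 1) * N) :=
          pow_le_pow_right₀ (by exact_mod_cast hm) (Nat.mul_le_mul_right _ n.le_succ)
    exact_mod_cast this
  -- Null words must be discarded: as `Real.logb 2 0 = 0`, they would pass as carrying no
  -- information.
  · have hpos : ∀ᵐ x ∂μ, 0 < q (itinerary f ξ N x) := by
      have h0 : ∀ b, q b = 0 → ∀ᵐ x ∂μ, itinerary f ξ N x ≠ b := by
        intro b hb
        rw [hq, measureReal_eq_zero_iff] at hb
        rw [ae_iff]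
        simpa [Set.preimage] using hb
      have h1 : ∀ᵐ x ∂μ, ∀ b, q b = 0 → itinerary f ξ N x ≠ b :=
        ae_all_iff.2 fun b => by
          by_cases hb : q b = 0
          · simpa [hb] using h0 b hb
          · simp [hb]
      filter_upwards [h1] with x hx
      exact lt_of_le_of_ne measureReal_nonneg fun h => hx _ h.symm rfl
    have hpos' : ∀ᵐ x ∂μ, ∀ i, 0 < q (itinerary f ξ N (f^[i] x)) :=
      ae_all_iff.2 fun i =>
        (hf.toMeasurePreserving.iterate i).quasiMeasurePreserving.ae hpos
    refine le_trans (measure_mono_ae ?_) hn1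
    filter_upwards [hpos'] with x hx hxS
    by_contra hlt
    refine hxS ?_
    have hlt' : birkhoffAverage ℝ f g (n * N) x < H + δ := by
      have h1 : ‖birkhoffAverage ℝ f g (n * N) x - ∫ x, g x ∂μ‖ < δ := not_le.1 hlt
      rw [hgint, Real.norm_eq_abs] at h1
      linarith [(abs_lt.1 h1).2]
    have hnN : (0 : ℝ) < (n * N : ℕ) := by positivity
    have hsum : ∑ j ∈ Finset.range N, ∑ k ∈ Finset.range n, g (f^[j + k * N] x) ≤
        ∑ j ∈ Finset.range N, n * (H + δ) := by
      rw [← sum_range_mul_eq_sum_sum (fun i => g (f^[i] x))]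
      rw [birkhoffAverage, smul_eq_mul, inv_mul_lt_iff₀ hnN, birkhoffSum] at hlt'
      simp only [Finset.sum_const, Finset.card_range, nsmul_eq_mul]
      push_cast at hlt'
      linarith
    -- Pigeonhole: some offset does no worse than the average over the N residues.
    obtain ⟨j, hj, hjle⟩ := Finset.exists_le_of_sum_le (by simpa using hN.ne') hsum
    obtain ⟨r, hr⟩ := exists_itinerary_eq_spliceWord f ξ (n := n) hN x ⟨j, Finset.mem_range.1 hj⟩
    rw [hr]
    refine Finset.mem_image_of_mem _ ?_
    simp only [Finset.mem_product, Finset.mem_univ, true_and, h𝓑, Finset.mem_filter]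
    refine ⟨fun k => hx _, ?_⟩
    rw [Finset.sum_range] at hjle
    exact hjle

/-! ### Achievability and the capacity bound -/

/-- The objective is achievable over every alphabet whose capacity exceeds the entropy. -/
theorem achievable_of_metricEntropy_lt {X : Type*} [MetricSpace X] [CompactSpace X]
    [MeasurableSpace X] [BorelSpace X] {f : X → X} {μ : Measure X} [IsProbabilityMeasure μ]
    (hf : Ergodic f μ) {p ε : ℝ} (hp : 0 < p) (hε : 0 < ε) {m : ℕ} (hm : 0 < m)
    (h : metricEntropy f μ < ENNReal.ofReal (Real.logb 2 m)) : Achievable f μ p ε m := by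
  have : Nonempty X := nonempty_of_isProbabilityMeasure μ
  obtain ⟨n, ξ, rep, hξ, hrep⟩ := exists_measurable_fin_dist_le X
    -- Chosen so that r^p = ε / 2; the other half of ε pays for the uncovered points.
    (r := (ε / 2) ^ p⁻¹) (Real.rpow_pos_of_pos (half_pos hε) _)
  have hP : partitionEntropy f μ (.ofMap ξ hξ) < ENNReal.ofReal (Real.logb 2 m) :=
    (le_iSup (partitionEntropy f μ) _).trans_lt h
  obtain ⟨N, hNlt, hN⟩ :=
    ((eventually_lt_of_limsup_lt hP).and (eventually_gt_atTop 0)).exists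
  have hN0 : (0 : ℝ) < N := by exact_mod_cast hN
  replace hNlt := (ENNReal.ofReal_lt_ofReal_iff'.1 hNlt).1
  rw [div_lt_iff₀ hN0, mul_comm, joinEntropy_ofMap] at hNlt
  -- The maximum with 1 allows division by D^p even if X is a single point.
  set D := max 1 (Metric.diam (univ : Set X))
  have hD : ∀ x y : X, dist x y ≤ D := fun x y =>
    (Metric.dist_le_diam_of_mem isCompact_univ.isBounded (mem_univ x) (mem_univ y)).trans
      (le_max_right _ _)
  have hDp : 0 < ENNReal.ofReal (D ^ p) :=
    ENNReal.ofReal_pos.2 (Real.rpow_pos_of_pos (lt_max_of_lt_left one_pos) _)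
  obtain ⟨L, S, hL, hS, hμ⟩ := exists_itinerary_cover hf hξ hm hN hNlt
    (η := ENNReal.ofReal (ε / 2) / ENNReal.ofReal (D ^ p))
    (ENNReal.div_pos (ENNReal.ofReal_pos.2 (half_pos hε)).ne' ENNReal.ofReal_ne_top)
  obtain ⟨c, hc⟩ := exists_block_policy hf.toMeasurePreserving hξ hm hL S hS rep hp hrep hD
  refine ⟨c, limsup_le_of_le (by isBoundedDefault) ?_⟩
  filter_upwards [eventually_ge_atTop L] with t ht
  refine (hc t ht).trans ?_
  rw [Real.rpow_inv_rpow (half_pos hε).le hp.ne']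
  calc ENNReal.ofReal (ε / 2) + ENNReal.ofReal (D ^ p) * μ {x | itinerary f ξ L x ∉ S}
      ≤ ENNReal.ofReal (ε / 2) + ENNReal.ofReal (D ^ p) *
          (ENNReal.ofReal (ε / 2) / ENNReal.ofReal (D ^ p)) := by gcongr
    _ = ENNReal.ofReal ε := by
      rw [ENNReal.mul_div_cancel hDp.ne' ENNReal.ofReal_ne_top,
        ← ENNReal.ofReal_add (half_pos hε).le (half_pos hε).le, add_halves]

/-- A larger tolerance only enlarges the set of admissible m. Monotonicity yields the limit as ε ↓
0. -/
theorem antitone_capacityAt {X : Type*} [MeasurableSpace X] [MetricSpace X]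
    (f : X → X) (μ : Measure X) (p : ℝ) : Antitone fun ε : ℝ => capacityAt f μ p ε := by
  intro ε₁ ε₂ hle
  refine sInf_le_sInf ?_
  rintro C ⟨m, hm, hach, rfl⟩
  refine ⟨m, hm, fun m' hm' => ?_, rfl⟩
  obtain ⟨c, hc⟩ := hach m' hm'
  exact ⟨c, le_trans hc (ENNReal.ofReal_le_ofReal hle)⟩

end ZeroDelayCoding

theorem mainTheorem3 {X : Type*} [MetricSpace X] [CompactSpace X] [MeasurableSpace X]
    [BorelSpace X] (f : X → X) (hf : Continuous f) (π₀ : Measure X) [IsProbabilityMeasure π₀]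
    (herg : Ergodic f π₀) (p : ℝ) (hp : 0 < p) :
    Tendsto (fun ε : ℝ => ZeroDelayCoding.capacityAt f π₀ p ε) (𝓝[>] 0)
        (𝓝 (ZeroDelayCoding.criticalCapacity f π₀ p)) ∧
      ZeroDelayCoding.criticalCapacity f π₀ p ≤
        ZeroDelayCoding.logOneAddFloorTwoPow (ZeroDelayCoding.metricEntropy f π₀) := by
  have hlim : Tendsto (fun ε : ℝ => ZeroDelayCoding.capacityAt f π₀ p ε) (𝓝[>] 0)
      (𝓝 (ZeroDelayCoding.criticalCapacity f π₀ p)) :=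
    tendsto_nhds_limUnder
      ⟨_, (ZeroDelayCoding.antitone_capacityAt f π₀ p).tendsto_nhdsGT 0⟩
  refine ⟨hlim, ?_⟩
  rw [ZeroDelayCoding.logOneAddFloorTwoPow]
  split_ifs with hh
  · exact le_top
  set h := ZeroDelayCoding.metricEntropy f π₀ with hdef
  refine le_of_tendsto hlim ?_
  filter_upwards [self_mem_nhdsWithin] with ε hε
  refine sInf_le ⟨1 + ⌊(2 : ℝ) ^ h.toReal⌋₊, by omega, fun m hm => ?_, by push_cast; rfl⟩
  have hm0 : 0 < m := by omega
  refine ZeroDelayCoding.achievable_of_metricEntropy_lt herg hp hε hm0 ?_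
  rw [← hdef, ← ENNReal.ofReal_toReal hh, ENNReal.ofReal_lt_ofReal_iff_of_nonneg
    ENNReal.toReal_nonneg, Real.lt_logb_iff_rpow_lt one_lt_two (by exact_mod_cast hm0)]
  refine (Nat.lt_floor_add_one _).trans_le ?_
  rw [add_comm]
  exact_mod_cast hm
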